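/- Let $(M,\omega)$ be a symplectic manifold and let $\pi\colon P\to M$ be a smooth principal $S^1$-bundle with a contact form $\alpha$ on $P$ such that $d\alpha=\pi^*\omega$; write $\xi=\ker\alpha$. (This includes every prequantization of a closed symplectic manifold with integral class $[\omega]$.) An embedded submanifold $\Lambda\subset M$ is called symplectic coisotropic if $(T_x\Lambda)^{\omega}\subset T_x\Lambda$ for all $x\in\Lambda$. An embedded submanifold $Y\subset P$ is called contact coisotropic if $(T_aY\cap\xi_a)^{\perp_{d\alpha}}\subset T_aY\cap\xi_a$ for all $a\in Y$, where $\perp_{d\alpha}$ is the orthogonal complement in $\xi_a$ with respect to $d\alpha|_{\xi_a}$. Let $\Lambda\subset M$ be an embedded submanifold of dimension $k$. Then $\pi^{-1}(\Lambda)$ is an embedded submanifold of $P$ of dimension $k+1$, and: 1. if $\pi^{-1}(\Lambda)$ is contact coisotropic, then $\Lambda$ is symplectic coisotropic; 2. if $\Lambda$ is symplectic coisotropic, then $\pi^{-1}(\Lambda)$ is contact coisotropic. Moreover, for all smooth functions $F,G\colon M\to\mathbb{R}$, $$\{\pi^*F,\pi^*G\}_c=\pi^*\{F,G\}.$$ Here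 $\{F,G\}=dF(X_G)$, where $X_G$ is the vector field on $M$ with $\omega(X_G,\cdot)=-dG$. For smooth functions $f,g$ on $P$, $\{f,g\}_c=df(X_g)+dg(R)\,f$, where $R$ is the Reeb vector field of $\alpha$ and $X_g$ is the vector field on $P$ with $\alpha(X_g)=g$ and $d\alpha(X_g,\cdot)=dg(R)\,\alpha-dg$. -/

import Mathlib

open scoped Manifold ContDiff Topology
open Set

noncomputable section

namespace CoisoCorr

/-! ### Linear algebra: solving the equations of Reeb and Hamiltonian vectors -/

section LinearAlgebra

variable {V : Type*} [NormedAddCommGroup V] [NormedSpace ℝ V]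

/-- The linear map `v ↦ B(v, ·)` attached to an alternating `2`-form `B`. -/
def flatMap (B : V [⋀^Fin 2]→L[ℝ] ℝ) : V →ₗ[ℝ] (V →L[ℝ] ℝ) where
  toFun v := (ContinuousAlternatingMap.ofSubsingleton ℝ V ℝ (0 : Fin 1)).symm (B.curryLeft v)
  map_add' v w := by ext; simp
  map_smul' c v := by ext; simp

theorem flatMap_apply (B : V [⋀^Fin 2]→L[ℝ] ℝ) (v w : V) : flatMap B v w = B ![v, w] := by
  simp only [flatMap, LinearMap.coe_mk, AddHom.coe_mk]
  change B.curryLeft v (fun _ => w) = B ![v, w]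
  rw [ContinuousAlternatingMap.curryLeft_apply_apply]
  congr 1
  ext i
  fin_cases i <;> rfl

theorem alternating_self (B : V [⋀^Fin 2]→L[ℝ] ℝ) (v : V) : B ![v, v] = 0 :=
  B.map_eq_zero_of_eq ![v, v] (i := 0) (j := 1) rfl (by decide)

theorem alternating_swap (B : V [⋀^Fin 2]→L[ℝ] ℝ) (v w : V) : B ![v, w] = -B ![w, v] := by
  have h := alternating_self B (v + w)
  rw [← flatMap_apply, map_add] at h
  simp only [add_apply, map_add, flatMap_apply, alternating_self] at h
  linarith

/-- The covector underlying a `1`-form. -/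
def covector (A : V [⋀^Fin 1]→L[ℝ] ℝ) : V →L[ℝ] ℝ :=
  (ContinuousAlternatingMap.ofSubsingleton ℝ V ℝ (0 : Fin 1)).symm A

theorem covector_apply (A : V [⋀^Fin 1]→L[ℝ] ℝ) (v : V) : covector A v = A ![v] := by
  change A (fun _ => v) = A ![v]
  congr 1
  ext i
  fin_cases i; rfl

variable [FiniteDimensional ℝ V]

/-- An injective linear map from a finite-dimensional space to its dual is bijective. -/
theorem bijective_of_injective_dual (L : V →ₗ[ℝ] (V →L[ℝ] ℝ)) (hL : Function.Injective L) :
    Function.Bijective L := by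
  have hd : Module.finrank ℝ V = Module.finrank ℝ (V →L[ℝ] ℝ) := by
    rw [← (LinearMap.toContinuousLinearMap (𝕜 := ℝ) (E := V) (F' := ℝ)).finrank_eq]
    exact (Subspace.dual_finrank_eq (K := ℝ) (V := V)).symm
  exact ⟨hL, (LinearMap.injective_iff_surjective_of_finrank_eq_finrank hd).mp hL⟩

theorem existsUnique_symplectic (B : V [⋀^Fin 2]→L[ℝ] ℝ)
    (hB : ∀ v, (∀ w, B ![v, w] = 0) → v = 0) (b : V →L[ℝ] ℝ) :
    ∃! v : V, ∀ w : V, B ![v, w] = -b w := by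
  have hinj : Function.Injective (flatMap B) := by
    rw [injective_iff_map_eq_zero]
    intro v hv
    exact hB v fun w => by rw [← flatMap_apply, hv]; rfl
  obtain ⟨v, hv, huniq⟩ := (bijective_of_injective_dual _ hinj).existsUnique (-b)
  refine ⟨v, fun w => by rw [← flatMap_apply, hv]; rfl, fun u hu => huniq u ?_⟩
  ext w
  rw [flatMap_apply, hu]; rfl

theorem contact_bijective (A : V [⋀^Fin 1]→L[ℝ] ℝ) (B : V [⋀^Fin 2]→L[ℝ] ℝ)
    (hB : ∀ v, A ![v] = 0 → (∀ w, A ![w] = 0 → B ![v, w] = 0) → v = 0) :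
    Function.Bijective (flatMap B + (covector A).toLinearMap.smulRight (covector A)) := by
  apply bijective_of_injective_dual
  rw [injective_iff_map_eq_zero]
  intro v hv
  have h : ∀ w, B ![v, w] + A ![v] * A ![w] = 0 := fun w => by
    have := DFunLike.congr_fun hv w
    simpa [flatMap_apply, covector_apply] using this
  have hA : A ![v] = 0 := by
    have := h v
    rw [alternating_self] at this
    simpa using this
  refine hB v hA fun w hw => ?_
  simpa [hA] using h w

theorem existsUnique_reeb (A : V [⋀^Fin 1]→L[ℝ] ℝ) (B : V [⋀^Fin 2]→L[ℝ] ℝ) (hA : A ≠ 0)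
    (hB : ∀ v, A ![v] = 0 → (∀ w, A ![w] = 0 → B ![v, w] = 0) → v = 0) :
    ∃! v : V, A ![v] = 1 ∧ ∀ w : V, B ![v, w] = 0 := by
  obtain ⟨R, hR, huniq⟩ := (contact_bijective A B hB).existsUnique (covector A)
  have h : ∀ w, B ![R, w] + A ![R] * A ![w] = A ![w] := fun w => by
    have := DFunLike.congr_fun hR w
    simpa [flatMap_apply, covector_apply] using this
  have hAR : A ![R] = 1 := by
    have h1 := h R
    rw [alternating_self] at h1
    by_contra hne
    have h0 : A ![R] = 0 := by
      have : A ![R] * (A ![R] - 1) = 0 := by linarith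
      rcases mul_eq_zero.mp this with h | h
      · exact h
      · exact absurd (by linarith) hne
    have hR0 : R = 0 := hB R h0 fun w hw => by simpa [h0, hw] using h w
    apply hA
    ext x
    have hx : x = ![x 0] := by ext i; fin_cases i; rfl
    rw [hx, ← h (x 0), h0, ← flatMap_apply, hR0]
    simp
  refine ⟨R, ⟨hAR, fun w => ?_⟩, fun u hu => huniq u ?_⟩
  · have := h w
    rw [hAR] at this
    linarith
  · ext w
    have := hu.2 w
    simp [flatMap_apply, covector_apply, hu.1, this]

theorem existsUnique_contact (A : V [⋀^Fin 1]→L[ℝ] ℝ) (B : V [⋀^Fin 2]→L[ℝ] ℝ)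
    (hB : ∀ v, A ![v] = 0 → (∀ w, A ![w] = 0 → B ![v, w] = 0) → v = 0)
    (R : V) (hR : A ![R] = 1 ∧ ∀ w : V, B ![R, w] = 0) (c : ℝ) (b : V →L[ℝ] ℝ) :
    ∃! v : V, A ![v] = c ∧ ∀ w : V, B ![v, w] = b R * A ![w] - b w := by
  obtain ⟨X, hX, huniq⟩ :=
    (contact_bijective A B hB).existsUnique (b R • covector A - b + c • covector A)
  have h : ∀ w, B ![X, w] + A ![X] * A ![w] = b R * A ![w] - b w + c * A ![w] := fun w => by
    have := DFunLike.congr_fun hX w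
    simpa [flatMap_apply, covector_apply] using this
  have hAX : A ![X] = c := by
    have := h R
    rw [alternating_swap, hR.2, hR.1] at this
    linarith
  refine ⟨X, ⟨hAX, fun w => ?_⟩, fun u hu => huniq u ?_⟩
  · have := h w
    rw [hAX] at this
    linarith
  · ext w
    have := hu.2 w
    simp [flatMap_apply, covector_apply, hu.1, this]

end LinearAlgebra

/-! ### Differential forms on manifolds without boundary -/

section Manifold

variable {E : Type*} [NormedAddCommGroup E] [NormedSpace ℝ E]
  {M : Type*} [TopologicalSpace M] [ChartedSpace E M]

variable (E M) in
/-- A (not necessarily smooth) differential `k`-form on `M`. -/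
abbrev DiffForm (k : ℕ) : Type _ :=
  ∀ p : M, TangentSpace 𝓘(ℝ, E) p [⋀^Fin k]→L[ℝ] ℝ

/-- The representation `(φ⁻¹)^* θ` of the form `θ` in the chart `φ = chartAt E p`;
it is meaningful on the target of the chart. -/
def DiffForm.inChart {k : ℕ} (θ : DiffForm E M k) (p : M) : E → E [⋀^Fin k]→L[ℝ] ℝ :=
  fun y => (θ ((chartAt E p).symm y)).compContinuousLinearMap
    (mfderiv 𝓘(ℝ, E) 𝓘(ℝ, E) (chartAt E p).symm y)

/-- A differential form is smooth if its representations in charts are smooth. -/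
def DiffForm.IsSmooth {k : ℕ} (θ : DiffForm E M k) : Prop :=
  ∀ p : M, ContDiffOn ℝ ∞ (θ.inChart p) (chartAt E p).target

/-- The exterior derivative `dθ = φ^* d((φ⁻¹)^* θ)`, computed at `p` in the chart
`φ = chartAt E p`. For smooth forms any other chart around `p` gives the same result. -/
def DiffForm.extDeriv {k : ℕ} (θ : DiffForm E M k) : DiffForm E M (k + 1) :=
  fun p => (_root_.extDeriv (θ.inChart p) (chartAt E p p)).compContinuousLinearMap
    (mfderiv 𝓘(ℝ, E) 𝓘(ℝ, E) (chartAt E p) p)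

/-- A symplectic form: a smooth closed non-degenerate `2`-form. -/
structure IsSymplecticForm (Ω : DiffForm E M 2) : Prop where
  smooth : Ω.IsSmooth
  closed : Ω.extDeriv = 0
  nondegenerate : ∀ (p : M) (v : TangentSpace 𝓘(ℝ, E) p),
    (∀ w : TangentSpace 𝓘(ℝ, E) p, Ω p ![v, w] = 0) → v = 0

/-- A contact form: a smooth nowhere vanishing `1`-form `α` such that `dα` is non-degenerate
on the hyperplanes `ξ_p = ker α_p`. -/
structure IsContactForm (α : DiffForm E M 1) : Prop where
  smooth : α.IsSmooth
  ne_zero : ∀ p : M, α p ≠ 0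
  nondegenerate : ∀ (p : M) (v : TangentSpace 𝓘(ℝ, E) p), α p ![v] = 0 →
    (∀ w : TangentSpace 𝓘(ℝ, E) p, α p ![w] = 0 → α.extDeriv p ![v, w] = 0) → v = 0

/-! ### Submanifolds and the coisotropic conditions -/

/-- `S` is an embedded submanifold (without boundary) of `M` of dimension `k`: around each of
its points there is a smooth chart of `M` in which `S` is a linear subspace of dimension `k`. -/
def IsEmbeddedSubmanifold (E : Type*) [NormedAddCommGroup E] [NormedSpace ℝ E]
    {M : Type*} [TopologicalSpace M] [ChartedSpace E M] (k : ℕ) (S : Set M) : Prop :=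
  ∀ p ∈ S, ∃ φ ∈ IsManifold.maximalAtlas 𝓘(ℝ, E) ∞ M, p ∈ φ.source ∧
    ∃ W : Submodule ℝ E, Module.finrank ℝ W = k ∧ φ.source ∩ S = φ.source ∩ φ ⁻¹' (W : Set E)

/-- The tangent space `T_p S` of a submanifold `S` at `p`: the velocities at time `0` of the
smooth curves in `M` that stay in `S` and start at `p`. -/
def tangentSet (S : Set M) (p : M) : Set (TangentSpace 𝓘(ℝ, E) p) :=
  {v | ∃ (γ : ℝ → M) (ε : ℝ), 0 < ε ∧ ContMDiffOn 𝓘(ℝ, ℝ) 𝓘(ℝ, E) ∞ γ (Ioo (-ε) ε) ∧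
    (∀ t ∈ Ioo (-ε) ε, γ t ∈ S) ∧ γ 0 = p ∧
    HasMFDerivAt 𝓘(ℝ, ℝ) 𝓘(ℝ, E) γ 0 (ContinuousLinearMap.toSpanSingleton ℝ (v : E))}

/-- Symplectic coisotropic: `(T_p S)^Ω ⊆ T_p S` for all `p ∈ S`. -/
def IsSymplecticCoisotropic (Ω : DiffForm E M 2) (S : Set M) : Prop :=
  ∀ p ∈ S, ∀ v : TangentSpace 𝓘(ℝ, E) p,
    (∀ w ∈ tangentSet (E := E) S p, Ω p ![v, w] = 0) → v ∈ tangentSet (E := E) S p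

/-- Contact coisotropic: `(T_p S ∩ ξ_p)^⊥ ⊆ T_p S ∩ ξ_p` for all `p ∈ S`, where `ξ = ker α` and
`⊥` is the orthogonal complement in `ξ_p` with respect to `dα`. -/
def IsContactCoisotropic (α : DiffForm E M 1) (S : Set M) : Prop :=
  ∀ p ∈ S, ∀ v : TangentSpace 𝓘(ℝ, E) p, α p ![v] = 0 →
    (∀ w ∈ tangentSet (E := E) S p, α p ![w] = 0 → α.extDeriv p ![v, w] = 0) →
      v ∈ tangentSet (E := E) S p

/-! ### Hamiltonian vector fields and brackets -/

/-- The differential `dF_p` of a function, as a covector at `p`. -/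
def differential (F : M → ℝ) (p : M) : TangentSpace 𝓘(ℝ, E) p →L[ℝ] ℝ :=
  mfderiv 𝓘(ℝ, E) 𝓘(ℝ, ℝ) F p

variable [FiniteDimensional ℝ E]

/-- The Hamiltonian vector field of `G`: the unique `X_G` with `Ω(X_G, ·) = -dG`. -/
def IsSymplecticForm.hamiltonian {Ω : DiffForm E M 2} (hΩ : IsSymplecticForm Ω) (G : M → ℝ)
    (p : M) : TangentSpace 𝓘(ℝ, E) p :=
  (existsUnique_symplectic (V := E) (Ω p) (hΩ.nondegenerate p)
    (differential (E := E) G p)).choose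

/-- The Poisson bracket `{F, G} = dF(X_G)`. -/
def IsSymplecticForm.bracket {Ω : DiffForm E M 2} (hΩ : IsSymplecticForm Ω) (F G : M → ℝ)
    (p : M) : ℝ :=
  differential (E := E) F p (hΩ.hamiltonian G p)

/-- The Reeb vector field: the unique `R` with `α(R) = 1` and `dα(R, ·) = 0`. -/
def IsContactForm.reeb {α : DiffForm E M 1} (hα : IsContactForm α) (p : M) :
    TangentSpace 𝓘(ℝ, E) p :=
  (existsUnique_reeb (V := E) (α p) (α.extDeriv p) (hα.ne_zero p) (hα.nondegenerate p)).choose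

/-- The contact vector field of `G`: the unique `X_G` with `α(X_G) = G` and
`dα(X_G, ·) = dG(R) α - dG`. -/
def IsContactForm.hamiltonian {α : DiffForm E M 1} (hα : IsContactForm α) (G : M → ℝ)
    (p : M) : TangentSpace 𝓘(ℝ, E) p :=
  (existsUnique_contact (V := E) (α p) (α.extDeriv p) (hα.nondegenerate p) (hα.reeb p)
    (existsUnique_reeb (V := E) (α p) (α.extDeriv p) (hα.ne_zero p)
      (hα.nondegenerate p)).choose_spec.1 (G p) (differential (E := E) G p)).choose

/-- The contact Poisson bracket `{F, G}_c = dF(X_G) + dG(R) F`. -/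
def IsContactForm.bracket {α : DiffForm E M 1} (hα : IsContactForm α) (F G : M → ℝ)
    (p : M) : ℝ :=
  differential (E := E) F p (hα.hamiltonian G p) + differential (E := E) G p (hα.reeb p) * F p

end Manifold

/-! ### Prequantization -/

section Prequantization

variable {E : Type*} [NormedAddCommGroup E] [NormedSpace ℝ E]
  {M : Type*} [TopologicalSpace M] [ChartedSpace E M]
  {F : Type*} [NormedAddCommGroup F] [NormedSpace ℝ F]
  {P : Type*} [TopologicalSpace P] [ChartedSpace F P] [MulAction Circle P]

/-- `π : P → M` is a smooth principal circle bundle: the circle acts smoothly on `P`, and `M` is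
covered by the base sets of smooth equivariant local trivializations
`π⁻¹(U) ≃ U × Circle`. -/
structure IsPrincipalCircleBundle (E : Type*) [NormedAddCommGroup E] [NormedSpace ℝ E]
    {M : Type*} [TopologicalSpace M] [ChartedSpace E M]
    (F : Type*) [NormedAddCommGroup F] [NormedSpace ℝ F]
    {P : Type*} [TopologicalSpace P] [ChartedSpace F P] [MulAction Circle P]
    (π : P → M) : Prop where
  smooth_action : ContMDiff ((𝓡 1).prod 𝓘(ℝ, F)) 𝓘(ℝ, F) ∞ (fun q : Circle × P => q.1 • q.2)
  locally_trivial : ∀ x : M, ∃ e : Bundle.Trivialization Circle π, x ∈ e.baseSet ∧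
    ContMDiffOn 𝓘(ℝ, F) (𝓘(ℝ, E).prod (𝓡 1)) ∞ e (π ⁻¹' e.baseSet) ∧
    ContMDiffOn (𝓘(ℝ, E).prod (𝓡 1)) 𝓘(ℝ, F) ∞ e.toOpenPartialHomeomorph.symm
      (e.baseSet ×ˢ univ) ∧
    ∀ a ∈ π ⁻¹' e.baseSet, ∀ g : Circle, e (g • a) = (π a, g * (e a).2)

/-- `(P, ker α)` is a prequantization of `(M, Ω)`: `π : P → M` is a principal circle bundle and
`α` is a contact form on `P` with `dα = π^* Ω`. In particular `α` may be any connection form with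
curvature `Ω`; no normalization of `α` on the fibres is imposed. -/
structure IsPrequantization (Ω : DiffForm E M 2) (α : DiffForm F P 1) (π : P → M) : Prop where
  principal : IsPrincipalCircleBundle E F π
  contact : IsContactForm α
  extDeriv_eq : ∀ a : P, α.extDeriv a =
    (Ω (π a)).compContinuousLinearMap (mfderiv 𝓘(ℝ, F) 𝓘(ℝ, E) π a)

end Prequantization

end CoisoCorr

end

open CoisoCorr

/-! Locally `P` is `M` times a circle and `π` is the projection, so every chart of `M` lifts to a
chart of `P` in which `π` is a surjective linear map with one-dimensional kernel
(`exists_lift_chart`). Hence `dπ` is onto, a chart flattening `Λ` to `W` lifts to one flattening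
`π⁻¹(Λ)` to the preimage of `W`, and `T(π⁻¹Λ) = (dπ)⁻¹(TΛ)` (`mem_tangentSet_preimage_iff`).

The equation `dα = π^*Ω` gives the rest. Since `dα(R, ·) = 0` and `Ω` is non-degenerate, the Reeb
field `R` is vertical (`mfderiv_reeb`). Subtracting multiples of `R` makes any lift horizontal, so
`dπ` maps `ξ` onto `TM` and carries `dα` to `Ω`. Orthogonality upstairs and downstairs then
correspond, which gives both coisotropic implications. For brackets, `d(G ∘ π)(R) = 0` turns the
contact equation into the Hamiltonian one, so the contact field of `G ∘ π` projects to `X_G`, and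
the correction term `dg(R) f` vanishes. -/

open scoped Manifold ContDiff Topology
open Set

noncomputable section

namespace CoisoCorr

/-! ### Charts and tangent spaces of flattened submanifolds -/

section Charts

variable {E : Type*} [NormedAddCommGroup E] [NormedSpace ℝ E]
  {M : Type*} [TopologicalSpace M] [ChartedSpace E M]

/-- A smooth open partial homeomorphism onto an open subset of the model space, with smooth
inverse, belongs to the maximal atlas. -/
theorem mem_maximalAtlas_of_contMDiffOn [IsManifold 𝓘(ℝ, E) ∞ M] {ψ : OpenPartialHomeomorph M E}
    (h : ContMDiffOn 𝓘(ℝ, E) 𝓘(ℝ, E) ∞ ψ ψ.source)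
    (h' : ContMDiffOn 𝓘(ℝ, E) 𝓘(ℝ, E) ∞ ψ.symm ψ.target) :
    ψ ∈ IsManifold.maximalAtlas 𝓘(ℝ, E) ∞ M := by
  have key : ∀ f : OpenPartialHomeomorph E E, ContMDiffOn 𝓘(ℝ, E) 𝓘(ℝ, E) ∞ f f.source →
      ContMDiffOn 𝓘(ℝ, E) 𝓘(ℝ, E) ∞ f.symm f.target → f ∈ contDiffGroupoid ∞ 𝓘(ℝ, E) := by
    intro f h1 h2
    rw [contMDiffOn_iff_contDiffOn] at h1 h2
    refine ⟨?_, ?_⟩ <;> simpa [contDiffPregroupoid]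
  rw [IsManifold.maximalAtlas, mem_maximalAtlas_iff]
  intro c hc
  have hc' := IsManifold.subset_maximalAtlas (I := 𝓘(ℝ, E)) (n := ∞) hc
  have c1 := contMDiffOn_of_mem_maximalAtlas hc'
  have c2 := contMDiffOn_symm_of_mem_maximalAtlas hc'
  have A : ContMDiffOn 𝓘(ℝ, E) 𝓘(ℝ, E) ∞ (ψ.symm.trans c) (ψ.symm.trans c).source :=
    c1.comp' h'
  have B : ContMDiffOn 𝓘(ℝ, E) 𝓘(ℝ, E) ∞ (c.symm.trans ψ) (c.symm.trans ψ).source :=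
    h.comp' c2
  -- The two transition maps are inverse to each other, so each of `A` and `B` supplies the inverse
  -- smoothness for the other.
  exact ⟨key _ A (by simpa using B), key _ B (by simpa using A)⟩

theorem mdifferentiable_of_mem_maximalAtlas {φ : OpenPartialHomeomorph M E}
    (hφ : φ ∈ IsManifold.maximalAtlas 𝓘(ℝ, E) ∞ M) :
    φ.MDifferentiable 𝓘(ℝ, E) 𝓘(ℝ, E) :=
  ⟨(contMDiffOn_of_mem_maximalAtlas hφ).mdifferentiableOn (by simp),
    (contMDiffOn_symm_of_mem_maximalAtlas hφ).mdifferentiableOn (by simp)⟩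

/-- In a chart flattening `S` to a linear subspace `W`, the tangent space of `S` is `W`. -/
theorem mem_tangentSet_iff [FiniteDimensional ℝ E] {φ : OpenPartialHomeomorph M E}
    (hφ : φ ∈ IsManifold.maximalAtlas 𝓘(ℝ, E) ∞ M) {S : Set M} {W : Submodule ℝ E}
    (hS : φ.source ∩ S = φ.source ∩ φ ⁻¹' (W : Set E)) {p : M} (hp : p ∈ φ.source) (hpS : p ∈ S)
    (v : TangentSpace 𝓘(ℝ, E) p) :
    v ∈ tangentSet (E := E) S p ↔ (mfderiv 𝓘(ℝ, E) 𝓘(ℝ, E) φ p v : E) ∈ W := by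
  have hd := mdifferentiable_of_mem_maximalAtlas hφ
  have hmem : ∀ q ∈ φ.source, (q ∈ S ↔ φ q ∈ W) := fun q hq => by
    have := Set.ext_iff.mp hS q
    simpa [hq] using this
  constructor
  · rintro ⟨γ, ε, hε, -, hγS, rfl, hγ⟩
    let D : E →L[ℝ] E := mfderiv 𝓘(ℝ, E) 𝓘(ℝ, E) φ (γ 0)
    have hφD : HasMFDerivAt 𝓘(ℝ, E) 𝓘(ℝ, E) φ (γ 0) D := (hd.mdifferentiableAt hp).hasMFDerivAt
    have hcomp : HasFDerivAt (φ ∘ γ) (D.comp (ContinuousLinearMap.toSpanSingleton ℝ (v : E))) 0 :=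
      hasMFDerivAt_iff_hasFDerivAt.mp (hφD.comp 0 hγ)
    have hder : HasDerivAt (φ ∘ γ) (D v) 0 := by
      have h : (D.comp (ContinuousLinearMap.toSpanSingleton ℝ (v : E))) 1 = D v := by
        change D ((1 : ℝ) • (v : E)) = D v
        rw [one_smul]
      rw [← h]
      exact hcomp.hasDerivAt
    change D v ∈ W
    have hW : IsClosed (W : Set E) := W.closed_of_finiteDimensional
    -- The velocity of `φ ∘ γ` is a limit of difference quotients, which lie in the closed subspace
    -- `W` for small `t`.
    refine hW.mem_of_tendsto (hasDerivAt_iff_tendsto_slope.mp hder) ?_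
    have h1 : ∀ᶠ t in 𝓝 (0 : ℝ), γ t ∈ φ.source :=
      hγ.continuousAt.eventually (φ.open_source.mem_nhds hp)
    have h2 : ∀ᶠ t in 𝓝 (0 : ℝ), t ∈ Ioo (-ε) ε := Ioo_mem_nhds (by linarith) hε
    filter_upwards [nhdsWithin_le_nhds h1, nhdsWithin_le_nhds h2] with t ht1 ht2
    exact W.smul_mem _ (W.sub_mem ((hmem _ ht1).1 (hγS t ht2)) ((hmem _ hp).1 hpS))
  · intro hv
    set u : E := mfderiv 𝓘(ℝ, E) 𝓘(ℝ, E) φ p v with hu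
    -- Conversely, a vector of `W` is realized by the straight line in `W` through `φ p`, pulled
    -- back by the chart; `ε` keeps the line inside the chart's target.
    let ℓ : ℝ → E := fun t => φ p + t • u
    have hℓ : ContDiff ℝ ∞ ℓ := by fun_prop
    have hℓ0 : ℓ 0 = φ p := by simp [ℓ]
    have hnhds : ∀ᶠ t in 𝓝 (0 : ℝ), ℓ t ∈ φ.target :=
      hℓ.continuous.continuousAt.eventually
        (φ.open_target.mem_nhds (by rw [hℓ0]; exact φ.map_source hp))
    obtain ⟨ε, hε, hball⟩ := Metric.eventually_nhds_iff_ball.mp hnhds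
    have hI : ∀ t ∈ Ioo (-ε) ε, ℓ t ∈ φ.target := fun t ht => hball t (by
      rw [Metric.mem_ball, Real.dist_eq, sub_zero]; exact abs_lt.mpr ht)
    refine ⟨φ.symm ∘ ℓ, ε, hε, ?_, fun t ht => ?_, ?_, ?_⟩
    · exact (contMDiffOn_symm_of_mem_maximalAtlas hφ).comp hℓ.contMDiff.contMDiffOn hI
    · have hs := φ.map_target (hI t ht)
      refine (hmem _ hs).2 ?_
      rw [φ.right_inv (hI t ht)]
      exact W.add_mem ((hmem _ hp).1 hpS) (W.smul_mem _ hv)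
    · simp [hℓ0, hp]
    · have h1 : HasMFDerivAt 𝓘(ℝ, ℝ) 𝓘(ℝ, E) ℓ 0 (ContinuousLinearMap.toSpanSingleton ℝ u) := by
        apply HasFDerivAt.hasMFDerivAt
        have := ((hasDerivAt_id (0 : ℝ)).smul_const u).const_add (φ p)
        rw [one_smul] at this
        exact this.hasFDerivAt
      have h2 : HasMFDerivAt 𝓘(ℝ, E) 𝓘(ℝ, E) φ.symm (ℓ 0)
          (mfderiv 𝓘(ℝ, E) 𝓘(ℝ, E) φ.symm (φ p)) := by
        rw [hℓ0]
        exact (hd.mdifferentiableAt_symm (φ.map_source hp)).hasMFDerivAt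
      have h3 : ContinuousLinearMap.toSpanSingleton ℝ (v : E) =
          (mfderiv 𝓘(ℝ, E) 𝓘(ℝ, E) φ.symm (φ p)).comp
            (ContinuousLinearMap.toSpanSingleton ℝ u) := by
        refine ContinuousLinearMap.ext_ring ?_
        have := DFunLike.congr_fun (hd.symm_comp_deriv hp) v
        change (1 : ℝ) • (v : E) = mfderiv 𝓘(ℝ, E) 𝓘(ℝ, E) φ.symm (φ p) ((1 : ℝ) • u)
        rw [one_smul, one_smul]
        exact this.symm
      exact (congrArg (fun D : ℝ →L[ℝ] E =>
        HasMFDerivAt 𝓘(ℝ, ℝ) 𝓘(ℝ, E) (φ.symm ∘ ℓ) 0 D) h3).mpr (h2.comp 0 h1)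

end Charts

/-! ### Lifted charts and preimages under a circle bundle -/

section Bundle

variable {E : Type*} [NormedAddCommGroup E] [NormedSpace ℝ E]
  {M : Type*} [TopologicalSpace M] [ChartedSpace E M]
  {V : Type*} [NormedAddCommGroup V] [NormedSpace ℝ V]
  {P : Type*} [TopologicalSpace P] [ChartedSpace V P] [MulAction Circle P]

theorem IsPrincipalCircleBundle.surjective {π : P → M} (hπ : IsPrincipalCircleBundle E V π) :
    Function.Surjective π := fun x => by
  obtain ⟨e, hx, -⟩ := hπ.locally_trivial x
  exact ⟨e.toOpenPartialHomeomorph.symm (x, 1), e.proj_symm_apply' hx⟩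

theorem IsPrincipalCircleBundle.contMDiff {π : P → M} (hπ : IsPrincipalCircleBundle E V π) :
    ContMDiff 𝓘(ℝ, V) 𝓘(ℝ, E) ∞ π := fun a => by
  obtain ⟨e, hx, he, -⟩ := hπ.locally_trivial (π a)
  have ha : π ⁻¹' e.baseSet ∈ 𝓝 a := by
    rw [← e.source_eq]
    exact e.open_source.mem_nhds (e.mem_source.2 hx)
  refine ((he.contMDiffAt ha).fst).congr_of_eventuallyEq ?_
  filter_upwards [ha] with b hb
  exact (e.coe_fst (e.mem_source.2 hb)).symm

/-- Every chart of the base lifts to a chart of the total space in which the projection is a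
surjective linear map. -/
theorem IsPrincipalCircleBundle.exists_lift_chart [IsManifold 𝓘(ℝ, V) ∞ P] {π : P → M}
    (hπ : IsPrincipalCircleBundle E V π) {φ : OpenPartialHomeomorph M E}
    (hφ : φ ∈ IsManifold.maximalAtlas 𝓘(ℝ, E) ∞ M) {a : P} (ha : π a ∈ φ.source) :
    ∃ ψ ∈ IsManifold.maximalAtlas 𝓘(ℝ, V) ∞ P, a ∈ ψ.source ∧
      ∃ L : V ≃L[ℝ] E × EuclideanSpace ℝ (Fin 1),
        ∀ b ∈ ψ.source, π b ∈ φ.source ∧ φ (π b) = (L (ψ b)).1 := by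
  obtain ⟨e, hx, he, he', -⟩ := hπ.locally_trivial (π a)
  have hae : a ∈ e.source := e.mem_source.2 hx
  rw [← e.source_eq] at he
  rw [← e.target_eq] at he'
  have hd : e.toOpenPartialHomeomorph.MDifferentiable 𝓘(ℝ, V) (𝓘(ℝ, E).prod (𝓡 1)) :=
    ⟨he.mdifferentiableOn (by simp), he'.mdifferentiableOn (by simp)⟩
  -- The model space `V` is not given as a product; the differential of the trivialization at `a`
  -- serves only as some linear identification with `E × ℝ`.
  let L : V ≃L[ℝ] E × EuclideanSpace ℝ (Fin 1) := hd.mfderiv hae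
  let c := chartAt (EuclideanSpace ℝ (Fin 1)) (e a).2
  have hc : c ∈ IsManifold.maximalAtlas (𝓡 1) ∞ Circle := IsManifold.chart_mem_maximalAtlas _
  let ψ : OpenPartialHomeomorph P V :=
    (e.toOpenPartialHomeomorph.trans (φ.prod c)).trans
      L.symm.toHomeomorph.toOpenPartialHomeomorph
  have hψ : ∀ b ∈ ψ.source, b ∈ e.source ∧ (e b).1 ∈ φ.source ∧ (e b).2 ∈ c.source :=
    fun b hb => by simpa [ψ] using hb
  have hψ' : ∀ y ∈ ψ.target, (L y).1 ∈ φ.target ∧ (L y).2 ∈ c.target ∧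
      (φ.symm (L y).1, c.symm (L y).2) ∈ e.target := fun y hy => by
    simpa [ψ, and_assoc] using hy
  refine ⟨ψ, mem_maximalAtlas_of_contMDiffOn ?_ ?_, ?_, L, fun b hb => ?_⟩
  · have h0 := he.mono fun b hb => (hψ b hb).1
    have h1 := (contMDiffOn_of_mem_maximalAtlas hφ).comp (contMDiff_fst.comp_contMDiffOn h0) fun b hb => (hψ b hb).2.1
    have h2 := (contMDiffOn_of_mem_maximalAtlas hc).comp (contMDiff_snd.comp_contMDiffOn h0) fun b hb => (hψ b hb).2.2
    exact L.symm.contDiff.contMDiff.comp_contMDiffOn (h1.prodMk_space h2)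
  · have h1 := (contMDiffOn_symm_of_mem_maximalAtlas hφ).comp
      (L.contDiff.fst.contMDiff.contMDiffOn (n := ∞)) fun y hy => (hψ' y hy).1
    have h2 := (contMDiffOn_symm_of_mem_maximalAtlas hc).comp
      (L.contDiff.snd.contMDiff.contMDiffOn (n := ∞)) fun y hy => (hψ' y hy).2.1
    exact he'.comp (h1.prodMk h2) fun y hy => (hψ' y hy).2.2
  · have : (e a).1 ∈ φ.source := by rwa [e.coe_fst hae]
    simpa [ψ, hae, c] using this
  · have h := hψ b hb
    rw [e.coe_fst h.1] at h
    refine ⟨h.2.1, ?_⟩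
    simp [ψ, e.coe_fst h.1]

omit [MulAction Circle P] in
/-- A lifted chart intertwines the differential of the projection with a linear projection. -/
theorem mfderiv_lift_chart {π : P → M} (hπ : ContMDiff 𝓘(ℝ, V) 𝓘(ℝ, E) ∞ π)
    {φ : OpenPartialHomeomorph M E} (hφ : φ ∈ IsManifold.maximalAtlas 𝓘(ℝ, E) ∞ M)
    {ψ : OpenPartialHomeomorph P V} (hψ : ψ ∈ IsManifold.maximalAtlas 𝓘(ℝ, V) ∞ P)
    {a : P} (ha : a ∈ ψ.source) (T : V →L[ℝ] E)
    (h : ∀ b ∈ ψ.source, π b ∈ φ.source ∧ φ (π b) = T (ψ b)) (v : TangentSpace 𝓘(ℝ, V) a) :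
    (mfderiv 𝓘(ℝ, E) 𝓘(ℝ, E) φ (π a) (mfderiv 𝓘(ℝ, V) 𝓘(ℝ, E) π a v) : E) =
      T (mfderiv 𝓘(ℝ, V) 𝓘(ℝ, V) ψ a v) := by
  have h1 := ((mdifferentiable_of_mem_maximalAtlas hφ).mdifferentiableAt (h a ha).1).hasMFDerivAt
  have h2 := ((hπ a).mdifferentiableAt (by simp)).hasMFDerivAt
  have h3 := ((mdifferentiable_of_mem_maximalAtlas hψ).mdifferentiableAt ha).hasMFDerivAt
  -- Near `a` one has `φ ∘ π = T ∘ ψ`; the chain rule on both sides and uniqueness of the derivative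
  -- give the claim.
  have h4 := (T.hasMFDerivAt (x := ψ a)).comp a h3
  have h5 := (h1.comp a h2).congr_of_eventuallyEq (f₁ := T ∘ ψ) (by
    filter_upwards [ψ.open_source.mem_nhds ha] with b hb
    exact (h b hb).2.symm)
  exact DFunLike.congr_fun (hasMFDerivAt_unique h5 h4) v

/-- In a lifted chart `dπ` is a linear projection, and any fibre component, here `0`, gives a
preimage; injectivity of the base chart's differential transfers this back to `M`. -/
theorem IsPrincipalCircleBundle.mfderiv_surjective [IsManifold 𝓘(ℝ, V) ∞ P] [IsManifold 𝓘(ℝ, E) ∞ M] {π : P → M}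
    (hπ : IsPrincipalCircleBundle E V π) (a : P) :
    Function.Surjective (mfderiv 𝓘(ℝ, V) 𝓘(ℝ, E) π a) := fun w => by
  have hφ := IsManifold.chart_mem_maximalAtlas (I := 𝓘(ℝ, E)) (n := ∞) (π a)
  have hpa := mem_chart_source E (π a)
  obtain ⟨ψ, hψ, ha, L, h⟩ := hπ.exists_lift_chart hφ hpa
  obtain ⟨v, hv⟩ := (mdifferentiable_of_mem_maximalAtlas hψ).mfderiv_surjective ha
    (L.symm (mfderiv 𝓘(ℝ, E) 𝓘(ℝ, E) (chartAt E (π a)) (π a) w, 0))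
  refine ⟨v, (mdifferentiable_of_mem_maximalAtlas hφ).mfderiv_injective hpa ?_⟩
  refine (mfderiv_lift_chart hπ.contMDiff hφ hψ ha
    ((ContinuousLinearMap.fst ℝ _ _).comp L.toContinuousLinearMap) h v).trans ?_
  rw [hv]
  simp

omit [ChartedSpace E M] [ChartedSpace V P] [MulAction Circle P] in
/-- The preimage of a flat submanifold is flat in lifted charts. -/
theorem preimage_flat {π : P → M} {φ : OpenPartialHomeomorph M E}
    {ψ : OpenPartialHomeomorph P V} {T : V →L[ℝ] E}
    (h : ∀ b ∈ ψ.source, π b ∈ φ.source ∧ φ (π b) = T (ψ b)) {S : Set M} {W : Submodule ℝ E}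
    (hS : φ.source ∩ S = φ.source ∩ φ ⁻¹' (W : Set E)) :
    ψ.source ∩ π ⁻¹' S = ψ.source ∩ ψ ⁻¹' (W.comap T.toLinearMap : Set V) := by
  ext b
  refine and_congr_right fun hb => ?_
  have := Set.ext_iff.mp hS (π b)
  simpa [(h b hb).1, (h b hb).2] using this

/-- Through `L` the preimage of `W` becomes `W × ℝ`; the added dimension is the fibre direction. -/
theorem finrank_comap_fst [FiniteDimensional ℝ E] (L : V ≃L[ℝ] E × EuclideanSpace ℝ (Fin 1))
    (W : Submodule ℝ E) :
    Module.finrank ℝ (W.comap ((ContinuousLinearMap.fst ℝ _ _).comp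
      L.toContinuousLinearMap).toLinearMap) = Module.finrank ℝ W + 1 := by
  let f : W.comap ((ContinuousLinearMap.fst ℝ _ _).comp L.toContinuousLinearMap).toLinearMap ≃ₗ[ℝ]
      W × EuclideanSpace ℝ (Fin 1) :=
    { toFun := fun v => (⟨(L v).1, v.2⟩, (L v).2)
      invFun := fun q => ⟨L.symm (q.1, q.2), by simp⟩
      left_inv := fun v => Subtype.ext (by simp)
      right_inv := fun q => by simp
      map_add' := fun v w => by
        have h : L (v + w : V) = L v + L w := map_add L _ _
        exact Prod.ext (Subtype.ext congr(($h).1)) congr(($h).2)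
      map_smul' := fun c v => by
        have h : L (c • v : V) = c • L v := map_smul L _ _
        exact Prod.ext (Subtype.ext congr(($h).1)) congr(($h).2) }
  rw [f.finrank_eq, Module.finrank_prod, finrank_euclideanSpace_fin]

/-- The preimage of an embedded submanifold is an embedded submanifold of one dimension more. -/
theorem IsPrincipalCircleBundle.isEmbeddedSubmanifold_preimage [FiniteDimensional ℝ E]
    [IsManifold 𝓘(ℝ, V) ∞ P] {π : P → M} (hπ : IsPrincipalCircleBundle E V π) {k : ℕ} {S : Set M}
    (hS : IsEmbeddedSubmanifold E k S) : IsEmbeddedSubmanifold V (k + 1) (π ⁻¹' S) := by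
  intro a ha
  obtain ⟨φ, hφ, hpφ, W, rfl, hW⟩ := hS (π a) ha
  obtain ⟨ψ, hψ, haψ, L, h⟩ := hπ.exists_lift_chart hφ hpφ
  exact ⟨ψ, hψ, haψ, _, finrank_comap_fst L W, preimage_flat
    (T := (ContinuousLinearMap.fst ℝ _ _).comp L.toContinuousLinearMap) h hW⟩

/-- The tangent space of the preimage is the preimage of the tangent space. -/
theorem IsPrincipalCircleBundle.mem_tangentSet_preimage_iff [FiniteDimensional ℝ E]
    [FiniteDimensional ℝ V] [IsManifold 𝓘(ℝ, V) ∞ P] {π : P → M}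
    (hπ : IsPrincipalCircleBundle E V π) {k : ℕ} {S : Set M}
    (hS : IsEmbeddedSubmanifold E k S) {a : P} (ha : π a ∈ S) (v : TangentSpace 𝓘(ℝ, V) a) :
    v ∈ tangentSet (E := V) (π ⁻¹' S) a ↔
      mfderiv 𝓘(ℝ, V) 𝓘(ℝ, E) π a v ∈ tangentSet (E := E) S (π a) := by
  obtain ⟨φ, hφ, hpφ, W, -, hW⟩ := hS (π a) ha
  obtain ⟨ψ, hψ, haψ, L, h⟩ := hπ.exists_lift_chart hφ hpφ
  let T : V →L[ℝ] E := (ContinuousLinearMap.fst ℝ _ _).comp L.toContinuousLinearMap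
  have hW' := preimage_flat (T := T) h hW
  rw [mem_tangentSet_iff hφ hW hpφ ha, mem_tangentSet_iff hψ hW' haψ ha,
    mfderiv_lift_chart hπ.contMDiff hφ hψ haψ T h]
  rfl

end Bundle

/-! ### The Reeb field and horizontal lifts -/

theorem one_form_sub_smul_eq_zero {V : Type*} [NormedAddCommGroup V] [NormedSpace ℝ V]
    (A : V [⋀^Fin 1]→L[ℝ] ℝ) (u : V) {v : V} (hv : A ![v] = 1) : A ![u - A ![u] • v] = 0 := by
  rw [← covector_apply] at hv
  simp only [← covector_apply, map_sub, map_smul, hv, smul_eq_mul, mul_one, sub_self]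

section Prequantization

variable {E : Type*} [NormedAddCommGroup E] [NormedSpace ℝ E]
  {M : Type*} [TopologicalSpace M] [ChartedSpace E M] [IsManifold 𝓘(ℝ, E) ∞ M]
  {V : Type*} [NormedAddCommGroup V] [NormedSpace ℝ V] [FiniteDimensional ℝ V]
  {P : Type*} [TopologicalSpace P] [ChartedSpace V P] [IsManifold 𝓘(ℝ, V) ∞ P]
  [MulAction Circle P]
  {Ω : DiffForm E M 2} {α : DiffForm V P 1} {π : P → M}

omit [IsManifold 𝓘(ℝ, E) ∞ M] [FiniteDimensional ℝ V] [IsManifold 𝓘(ℝ, V) ∞ P] in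
theorem IsPrequantization.extDeriv_apply (hP : IsPrequantization Ω α π) (a : P)
    (v w : TangentSpace 𝓘(ℝ, V) a) :
    α.extDeriv a ![v, w] =
      Ω (π a) ![mfderiv 𝓘(ℝ, V) 𝓘(ℝ, E) π a v, mfderiv 𝓘(ℝ, V) 𝓘(ℝ, E) π a w] := by
  rw [hP.extDeriv_eq, ContinuousAlternatingMap.compContinuousLinearMap_apply]
  congr 1
  ext i
  fin_cases i <;> rfl

omit [IsManifold 𝓘(ℝ, V) ∞ P] [MulAction Circle P] in
theorem IsContactForm.reeb_spec (hα : IsContactForm α) (a : P) :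
    α a ![hα.reeb a] = 1 ∧ ∀ w : TangentSpace 𝓘(ℝ, V) a, α.extDeriv a ![hα.reeb a, w] = 0 :=
  (existsUnique_reeb (V := V) (α a) (α.extDeriv a) (hα.ne_zero a)
    (hα.nondegenerate a)).choose_spec.1

/-- The Reeb vector field is vertical. -/
theorem IsPrequantization.mfderiv_reeb (hP : IsPrequantization Ω α π) (hΩ : IsSymplecticForm Ω)
    (a : P) : mfderiv 𝓘(ℝ, V) 𝓘(ℝ, E) π a (hP.contact.reeb a) = 0 := by
  -- Every test vector is some `dπ u`, and `Ω(dπ R, dπ u) = dα(R, u) = 0`.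
  refine hΩ.nondegenerate (π a) _ fun w => ?_
  obtain ⟨u, rfl⟩ := hP.principal.mfderiv_surjective a w
  rw [← hP.extDeriv_apply]
  exact (hP.contact.reeb_spec a).2 u

/-- Tangent vectors of the base have horizontal lifts. -/
theorem IsPrequantization.exists_horizontal_lift (hP : IsPrequantization Ω α π)
    (hΩ : IsSymplecticForm Ω) (a : P) (v : TangentSpace 𝓘(ℝ, E) (π a)) :
    ∃ u : TangentSpace 𝓘(ℝ, V) a, α a ![u] = 0 ∧ mfderiv 𝓘(ℝ, V) 𝓘(ℝ, E) π a u = v := by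
  obtain ⟨u, rfl⟩ := hP.principal.mfderiv_surjective a v
  -- Removing the Reeb component makes `u` horizontal, and since `R` is vertical the projection is
  -- unchanged.
  refine ⟨u - α a ![u] • hP.contact.reeb a, ?_, ?_⟩
  · exact one_form_sub_smul_eq_zero (V := V) (α a) u (hP.contact.reeb_spec a).1
  · rw [map_sub, map_smul, hP.mfderiv_reeb hΩ, smul_zero, sub_zero]

/-! ### The coisotropic correspondence -/

/-- A horizontal lift of a vector orthogonal to `TS` is `dα`-orthogonal to `T(π⁻¹S)`, hence tangent
to `π⁻¹S` by hypothesis, and its projection is tangent to `S`. -/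
theorem IsPrequantization.isSymplecticCoisotropic [FiniteDimensional ℝ E]
    (hP : IsPrequantization Ω α π) (hΩ : IsSymplecticForm Ω) {k : ℕ} {S : Set M}
    (hS : IsEmbeddedSubmanifold E k S) (h : IsContactCoisotropic α (π ⁻¹' S)) :
    IsSymplecticCoisotropic Ω S := by
  intro p hp v hv
  obtain ⟨a, rfl⟩ := hP.principal.surjective p
  obtain ⟨u, hu, rfl⟩ := hP.exists_horizontal_lift hΩ a v
  rw [← hP.principal.mem_tangentSet_preimage_iff hS hp]
  refine h a hp u hu fun w hw _ => ?_
  rw [hP.extDeriv_apply]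
  exact hv _ ((hP.principal.mem_tangentSet_preimage_iff hS hp w).1 hw)

theorem IsPrequantization.isContactCoisotropic [FiniteDimensional ℝ E]
    (hP : IsPrequantization Ω α π) (hΩ : IsSymplecticForm Ω) {k : ℕ} {S : Set M}
    (hS : IsEmbeddedSubmanifold E k S) (h : IsSymplecticCoisotropic Ω S) :
    IsContactCoisotropic α (π ⁻¹' S) := by
  intro a ha v _ hv
  rw [hP.principal.mem_tangentSet_preimage_iff hS ha]
  refine h (π a) ha _ fun w hw => ?_
  -- The orthogonality of `v` is known only against `T(π⁻¹S) ∩ ξ`, so the test vector `w` must be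
  -- lifted horizontally.
  obtain ⟨u, hu, rfl⟩ := hP.exists_horizontal_lift hΩ a w
  rw [← hP.extDeriv_apply]
  exact hv u ((hP.principal.mem_tangentSet_preimage_iff hS ha u).2 hw) hu

/-! ### Hamiltonian fields and brackets of pulled back functions -/

omit [IsManifold 𝓘(ℝ, E) ∞ M] [FiniteDimensional ℝ V] [IsManifold 𝓘(ℝ, V) ∞ P] in
theorem IsPrincipalCircleBundle.differential_comp (hπ : IsPrincipalCircleBundle E V π) {F : M → ℝ}
    (hF : ContMDiff 𝓘(ℝ, E) 𝓘(ℝ, ℝ) ∞ F) (a : P) (v : TangentSpace 𝓘(ℝ, V) a) :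
    differential (E := V) (F ∘ π) a v =
      differential (E := E) F (π a) (mfderiv 𝓘(ℝ, V) 𝓘(ℝ, E) π a v) := by
  unfold differential
  rw [mfderiv_comp a ((hF _).mdifferentiableAt (by simp))
    ((hπ.contMDiff a).mdifferentiableAt (by simp))]
  rfl

/-- The contact vector field of a pulled back function projects to the Hamiltonian vector
field. -/
theorem IsPrequantization.mfderiv_hamiltonian [FiniteDimensional ℝ E]
    (hP : IsPrequantization Ω α π) (hΩ : IsSymplecticForm Ω) {G : M → ℝ}
    (hG : ContMDiff 𝓘(ℝ, E) 𝓘(ℝ, ℝ) ∞ G) (a : P) :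
    mfderiv 𝓘(ℝ, V) 𝓘(ℝ, E) π a (hP.contact.hamiltonian (G ∘ π) a) = hΩ.hamiltonian G (π a) := by
  -- By uniqueness of `X_G`, it suffices that the projected vector satisfies `Ω(·, w) = -dG(w)` for
  -- all `w = dπ u`.
  refine (existsUnique_symplectic (V := E) (Ω (π a)) (hΩ.nondegenerate (π a))
    (differential (E := E) G (π a))).choose_spec.2 _ fun w => ?_
  obtain ⟨u, rfl⟩ := hP.principal.mfderiv_surjective a w
  have h : α.extDeriv a ![hP.contact.hamiltonian (G ∘ π) a, u] =
      differential (E := V) (G ∘ π) a (hP.contact.reeb a) * α a ![u] -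
        differential (E := V) (G ∘ π) a u :=
    (existsUnique_contact (V := V) (α a) (α.extDeriv a) (hP.contact.nondegenerate a)
      (hP.contact.reeb a) (hP.contact.reeb_spec a) ((G ∘ π) a)
      (differential (E := V) (G ∘ π) a)).choose_spec.1.2 u
  -- The term `d(G ∘ π)(R) α` drops out because `dπ R = 0`.
  rw [hP.extDeriv_apply, hP.principal.differential_comp hG, hP.principal.differential_comp hG,
    hP.mfderiv_reeb hΩ, map_zero, zero_mul, zero_sub] at h
  exact h

theorem IsPrequantization.bracket_comp [FiniteDimensional ℝ E]
    (hP : IsPrequantization Ω α π) (hΩ : IsSymplecticForm Ω) {F G : M → ℝ}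
    (hF : ContMDiff 𝓘(ℝ, E) 𝓘(ℝ, ℝ) ∞ F) (hG : ContMDiff 𝓘(ℝ, E) 𝓘(ℝ, ℝ) ∞ G) :
    hP.contact.bracket (F ∘ π) (G ∘ π) = hΩ.bracket F G ∘ π := by
  funext a
  rw [IsContactForm.bracket, hP.principal.differential_comp hF,
    hP.principal.differential_comp hG, hP.mfderiv_hamiltonian hΩ hG, hP.mfderiv_reeb hΩ,
    map_zero, zero_mul, add_zero]
  rfl

end Prequantization

end CoisoCorr

end

theorem mainTheorem10
    {E : Type*} [NormedAddCommGroup E] [NormedSpace ℝ E] [FiniteDimensional ℝ E]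
    {M : Type*} [TopologicalSpace M] [ChartedSpace E M] [IsManifold 𝓘(ℝ, E) ∞ M]
    {V : Type*} [NormedAddCommGroup V] [NormedSpace ℝ V] [FiniteDimensional ℝ V]
    {P : Type*} [TopologicalSpace P] [ChartedSpace V P] [IsManifold 𝓘(ℝ, V) ∞ P]
    [MulAction Circle P]
    (Ω : DiffForm E M 2) (hΩ : IsSymplecticForm Ω)
    (α : DiffForm V P 1) (π : P → M) (hP : IsPrequantization Ω α π) :
    (∀ (k : ℕ) (Λ : Set M), IsEmbeddedSubmanifold E k Λ →
      IsEmbeddedSubmanifold V (k + 1) (π ⁻¹' Λ) ∧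
      (IsContactCoisotropic α (π ⁻¹' Λ) → IsSymplecticCoisotropic Ω Λ) ∧
      (IsSymplecticCoisotropic Ω Λ → IsContactCoisotropic α (π ⁻¹' Λ))) ∧
    (∀ F G : M → ℝ, ContMDiff 𝓘(ℝ, E) 𝓘(ℝ, ℝ) ∞ F → ContMDiff 𝓘(ℝ, E) 𝓘(ℝ, ℝ) ∞ G →
      hP.contact.bracket (F ∘ π) (G ∘ π) = hΩ.bracket F G ∘ π) := by
  exact ⟨fun k Λ hΛ => ⟨hP.principal.isEmbeddedSubmanifold_preimage hΛ,
    hP.isSymplecticCoisotropic hΩ hΛ, hP.isContactCoisotropic hΩ hΛ⟩,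
    fun F G hF hG => hP.bracket_comp hΩ hF hG⟩
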